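/- **Theorem (strong consistency of the ABP estimator).** Let $D\subseteq\mathbb{R}^d$, let $E\subseteq\mathbb{R}_+=[0,\infty)$ be closed, let $\Theta\subseteq\mathbb{R}^k$ be compact, and let $\epsilon_0\in E$, $\theta_0\in\Theta$. Let $f(x,u,\theta)$ and $g(x,u,\theta)=(g_1,\dots,g_m)(x,u,\theta)$ be real- and $\mathbb{R}^m$-valued functions that are jointly continuous in $(x,u,\theta)\in\mathbb{R}^p\times D\times\Theta$ and convex in $x$ for each $(u,\theta)\in D\times\Theta$, and assume that for every $(u,\theta)\in D\times\Theta$ there is an $x$ with $g_j(x,u,\theta)<0$ for all $j$. Put $V(u,\theta)=\inf_x\{f(x,u,\theta) : g(x,u,\theta)\le 0\}$ and, for $\epsilon\ge 0$, $$S(u,\epsilon,\theta)=\{x : f(x,u,\theta)\le V(u,\theta)+\epsilon,\ g(x,u,\theta)\le 0\}.$$ Let $W\subset\mathbb{R}^p$ be a bounded convex set. Write $C\oplus W=\{c+w : c\in C, w\in W\}$ and $d^2(y,C)=\inf_{c\in C}\|y-c\|^2\in[0,\infty]$ (so $d^2(y,\emptyset)=\infty$). Let $(U_i,X_i,W_i)$,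 $i=1,2,\dots$, be i.i.d. random vectors such that almost surely $U_i\in D$, $X_i\in S(U_i,\epsilon_0,\theta_0)$ and $W_i\in W$, with $\mathbb{E}(W_i)=0$; put $Y_i=X_i+W_i$. Assume the identifiability condition $$\mathbb{E}\big(d^2(Y_i,S(U_i,\epsilon,\theta)\oplus W)\big)>0\quad\text{for all } (\epsilon,\theta)\in (E\cap[0,\epsilon_0])\times\Theta \text{ with } (\epsilon,\theta)\ne(\epsilon_0,\theta_0).$$ For each $n\ge 1$ let $\lambda_n=1/n$, let $z_n\ge 0$ be such that $\lim_n n z_n=0$, and let $(\hat\epsilon_n,\hat\theta_n)\in E\times\Theta$ be any estimate that almost surely satisfies $$\frac1n\sum_{i=1}^n d^2(Y_i,S(U_i,\hat\epsilon_n,\hat\theta_n)\oplus W)+\lambda_n\hat\epsilon_n\ \le\ \inf_{(\epsilon,\theta)\in E\times\Theta}\Big\{\frac1n\sum_{i=1}^n d^2(Y_i,S(U_i,\epsilon,\theta)\oplus W)+\lambda_n\epsilon\Big\}+z_n .$$ Then $(\hat\epsilon_n,\hat\theta_n)\to(\epsilon_0,\theta_0)$ almost surely as $n\to\infty$. -/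

import Mathlib

open MeasureTheory ProbabilityTheory Filter Topology
open scoped NNReal ENNReal Pointwise

noncomputable section

namespace InverseApproxOpt

/-- The feasible set `{x | g(x,u,θ) ≤ 0}` of a parametric program with finitely many scalar
constraints `g j`. -/
def feasibleSet {X Υ T : Type*} {m : ℕ} (g : Fin m → X → Υ → T → ℝ) (u : Υ) (θ : T) : Set X :=
  {x | ∀ j, g j x u θ ≤ 0}

/-- The value function `V(u,θ)` of the parametric program: the infimum of `f(x,u,θ)` over feasible
`x`, as an extended real number. -/
def valueFn {X Υ T : Type*} {m : ℕ} (f : X → Υ → T → ℝ) (g : Fin m → X → Υ → T → ℝ)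
    (u : Υ) (θ : T) : EReal :=
  ⨅ x ∈ feasibleSet g u θ, ((f x u θ : ℝ) : EReal)

/-- The set `S(u,ε,θ) = {x | f(x,u,θ) ≤ V(u,θ) + ε, g(x,u,θ) ≤ 0}` of `ε`-optimal solutions. -/
def solSet {X Υ T : Type*} {m : ℕ} (f : X → Υ → T → ℝ) (g : Fin m → X → Υ → T → ℝ)
    (u : Υ) (ε : ℝ≥0) (θ : T) : Set X :=
  {x | ((f x u θ : ℝ) : EReal) ≤ valueFn f g u θ + ((ε : ℝ) : EReal) ∧ x ∈ feasibleSet g u θ}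

/-- The squared distance `d²(y,C)` from a point to a set, with value `∞` if `C` is empty. -/
def sqDist {X : Type*} [PseudoEMetricSpace X] (y : X) (C : Set X) : ℝ≥0∞ :=
  Metric.infEDist y C ^ 2

/-- The objective `(1/n) ∑_{i<n} d²(yᵢ, S(uᵢ,ε,θ) ⊕ W) + lam * ε` at `(ε,θ)`, for data `(uᵢ,yᵢ)`. -/
def abpObjective {X Υ T : Type*} [NormedAddCommGroup X] {m : ℕ}
    (f : X → Υ → T → ℝ) (g : Fin m → X → Υ → T → ℝ) (W : Set X)
    (u : ℕ → Υ) (y : ℕ → X) (n : ℕ) (lam : ℝ≥0) (q : ℝ≥0 × T) : ℝ≥0∞ :=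
  (n : ℝ≥0∞)⁻¹ * ∑ i ∈ Finset.range n, sqDist (y i) (solSet f g (u i) q.1 q.2 + W)
    + (lam : ℝ≥0∞) * (q.1 : ℝ≥0∞)

/-- The points of `A` whose value under `F` is within `z` of the infimum of `F` over `A`. -/
def approxArgmin {Q : Type*} (F : Q → ℝ≥0∞) (A : Set Q) (z : ℝ≥0) : Set Q :=
  {q | q ∈ A ∧ F q ≤ (⨅ q' ∈ A, F q') + (z : ℝ≥0∞)}

end InverseApproxOpt

end

/-!
With `λₙ = 1/n` the total loss is bounded along the estimates. The true parameter
`(ε₀, θ₀)` has zero empirical loss almost surely, so comparing `(ε̂ₙ, θ̂ₙ)` with it and multiplying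
by `n` gives
`∑_{i<n} d²(Yᵢ, S(Uᵢ, ε̂ₙ, θ̂ₙ) ⊕ W) + ε̂ₙ ≤ ε₀ + n zₙ` (`sum_add_le_of_mem_approxArgmin`).
Hence `limsup ε̂ₙ ≤ ε₀`, the estimates finally stay in a compact set, and the total loss stays
bounded.

At a wrong parameter `q` with `ε ≤ ε₀` the total loss diverges, uniformly near `q`. Indeed the
distance `d(y, S(u, q) ⊕ W)` is jointly lower semicontinuous in `(y, u, q)`
(`eventually_lt_infEDist_solSet_add`), because Slater's condition makes the value function upper
semicontinuous and hence the graph of `S` closed (`mem_solSet_of_tendsto`). Identifiability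
therefore yields a neighbourhood `N` of `q`, a constant `c > 0` and an open set of data of positive
probability on which the loss is at least `c` throughout `N` (`exists_isOpen_measure_ne_zero`). By
the second Borel–Cantelli lemma the sample visits this set infinitely often
(`ae_frequently_mem_of_iIndepFun`), so the estimates finally leave `N`. This needs no law of large
numbers and no integrability of the loss.

Countably many such neighbourhoods cover the wrong parameters with `ε ≤ ε₀`. Almost surely none of
these parameters is then a cluster point of the estimates, and compactness gives convergence.
-/

namespace InverseApproxOpt

/-! ### Semicontinuity of the solution sets -/

lemma tendsto_of_continuousOn_prod {X Υ T ι : Type*} [TopologicalSpace X] [TopologicalSpace Υ]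
    [TopologicalSpace T] {f : X → Υ → T → ℝ} {D : Set Υ} {Θ : Set T}
    (hf : ContinuousOn (fun t : X × Υ × T => f t.1 t.2.1 t.2.2) (Set.univ ×ˢ D ×ˢ Θ))
    {l : Filter ι} {xs : ι → X} {us : ι → Υ} {θs : ι → T} {x : X} {u : Υ} {θ : T}
    (hu : u ∈ D) (hθ : θ ∈ Θ) (hus : ∀ i, us i ∈ D) (hθs : ∀ i, θs i ∈ Θ)
    (hxl : Tendsto xs l (𝓝 x)) (hul : Tendsto us l (𝓝 u)) (hθl : Tendsto θs l (𝓝 θ)) :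
    Tendsto (fun i => f (xs i) (us i) (θs i)) l (𝓝 (f x u θ)) :=
  (hf (x, u, θ) ⟨trivial, hu, hθ⟩).tendsto.comp (tendsto_nhdsWithin_iff.2
    ⟨hxl.prodMk_nhds (hul.prodMk_nhds hθl),
      Eventually.of_forall fun i => ⟨trivial, hus i, hθs i⟩⟩)

/-- Moving a feasible point slightly towards a Slater point makes all constraints strict. -/
lemma strict_of_convex_comb {X Υ T : Type*} [AddCommGroup X] [Module ℝ X] {m : ℕ}
    {g : Fin m → X → Υ → T → ℝ} {u : Υ} {θ : T}
    (hg : ∀ j, ConvexOn ℝ Set.univ (fun x => g j x u θ)) {x s : X}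
    (hx : x ∈ feasibleSet g u θ) (hs : ∀ j, g j s u θ < 0) {t : ℝ} (ht : 0 < t) (ht1 : t ≤ 1)
    (j : Fin m) : g j ((1 - t) • x + t • s) u θ < 0 := by
  have h := (hg j).2 (Set.mem_univ x) (Set.mem_univ s) (sub_nonneg.2 ht1) ht.le (by ring)
  have h1 : (1 - t) * g j x u θ ≤ 0 := mul_nonpos_of_nonneg_of_nonpos (sub_nonneg.2 ht1) (hx j)
  have h2 : t * g j s u θ < 0 := mul_neg_of_pos_of_neg ht (hs j)
  simp only [smul_eq_mul] at h
  linarith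

lemma mem_solSet_of_forall_le {X Υ T : Type*} {m : ℕ} {f : X → Υ → T → ℝ}
    {g : Fin m → X → Υ → T → ℝ} {u : Υ} {ε : ℝ≥0} {θ : T} {x : X}
    (hx : x ∈ feasibleSet g u θ) (h : ∀ x' ∈ feasibleSet g u θ, f x u θ ≤ f x' u θ + ε) :
    x ∈ solSet f g u ε θ := by
  refine ⟨?_, hx⟩
  have h1 : ((f x u θ - ε : ℝ) : EReal) ≤ valueFn f g u θ :=
    le_iInf₂ fun x' hx' => EReal.coe_le_coe_iff.2 (by linarith [h x' hx'])
  calc ((f x u θ : ℝ) : EReal) = ((f x u θ - ε : ℝ) : EReal) + ((ε : ℝ) : EReal) := by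
        rw [← EReal.coe_add, sub_add_cancel]
    _ ≤ _ := by gcongr

lemma le_add_of_mem_solSet {X Υ T : Type*} {m : ℕ} {f : X → Υ → T → ℝ}
    {g : Fin m → X → Υ → T → ℝ} {u : Υ} {ε : ℝ≥0} {θ : T} {x x' : X}
    (hx : x ∈ solSet f g u ε θ) (hx' : x' ∈ feasibleSet g u θ) :
    f x u θ ≤ f x' u θ + ε := by
  have h1 : valueFn f g u θ ≤ ((f x' u θ : ℝ) : EReal) := iInf₂_le x' hx'
  have h2 : ((f x u θ : ℝ) : EReal) ≤ ((f x' u θ + ε : ℝ) : EReal) := by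
    rw [EReal.coe_add]
    exact hx.1.trans (by gcongr)
  exact EReal.coe_le_coe_iff.1 h2

/-- The graph of `(u, ε, θ) ↦ S(u, ε, θ)` is sequentially closed. This rests on the upper
semicontinuity of the value function: under Slater's condition the infimum may be taken over
strictly feasible points, and those stay feasible under small perturbations of `(u, θ)`. -/
lemma mem_solSet_of_tendsto {X Υ T : Type*} [NormedAddCommGroup X] [NormedSpace ℝ X]
    [TopologicalSpace Υ] [TopologicalSpace T] {m : ℕ} {f : X → Υ → T → ℝ}
    {g : Fin m → X → Υ → T → ℝ} {D : Set Υ} {Θ : Set T}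
    (hf : ContinuousOn (fun t : X × Υ × T => f t.1 t.2.1 t.2.2) (Set.univ ×ˢ D ×ˢ Θ))
    (hg : ∀ j, ContinuousOn (fun t : X × Υ × T => g j t.1 t.2.1 t.2.2) (Set.univ ×ˢ D ×ˢ Θ))
    (hg_conv : ∀ j, ∀ u ∈ D, ∀ θ ∈ Θ, ConvexOn ℝ Set.univ (fun x => g j x u θ))
    (hSlater : ∀ u ∈ D, ∀ θ ∈ Θ, ∃ x, ∀ j, g j x u θ < 0)
    {xs : ℕ → X} {us : ℕ → Υ} {εs : ℕ → ℝ≥0} {θs : ℕ → T} {x : X} {u : Υ} {ε : ℝ≥0} {θ : T}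
    (hu : u ∈ D) (hθ : θ ∈ Θ) (hus : ∀ i, us i ∈ D) (hθs : ∀ i, θs i ∈ Θ)
    (hx : Tendsto xs atTop (𝓝 x)) (hul : Tendsto us atTop (𝓝 u))
    (hεl : Tendsto εs atTop (𝓝 ε)) (hθl : Tendsto θs atTop (𝓝 θ))
    (hmem : ∀ i, xs i ∈ solSet f g (us i) (εs i) (θs i)) : x ∈ solSet f g u ε θ := by
  have hlim := tendsto_of_continuousOn_prod hf hu hθ hus hθs hx hul hθl
  have hε' : Tendsto (fun i => (εs i : ℝ)) atTop (𝓝 (ε : ℝ)) :=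
    (NNReal.continuous_coe.tendsto ε).comp hεl
  -- Strictly feasible points remain feasible along the sequence, so they compete with `xs i`.
  have strict : ∀ x', (∀ j, g j x' u θ < 0) → f x u θ ≤ f x' u θ + ε := by
    intro x' hx'
    have hev : ∀ᶠ i in atTop, ∀ j, g j x' (us i) (θs i) < 0 := eventually_all.2 fun j =>
      (tendsto_of_continuousOn_prod (hg j) hu hθ hus hθs tendsto_const_nhds hul hθl).eventually_lt
        tendsto_const_nhds (hx' j)
    exact le_of_tendsto_of_tendsto hlim
      ((tendsto_of_continuousOn_prod hf hu hθ hus hθs tendsto_const_nhds hul hθl).add hε')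
      (hev.mono fun i hi => le_add_of_mem_solSet (hmem i) fun j => (hi j).le)
  refine mem_solSet_of_forall_le (fun j => le_of_tendsto
    (tendsto_of_continuousOn_prod (hg j) hu hθ hus hθs hx hul hθl)
    (Eventually.of_forall fun i => (hmem i).2 j)) fun x' hx' => ?_
  obtain ⟨s, hs⟩ := hSlater u hu θ hθ
  -- A feasible `x'` is the limit of strictly feasible points on the segment to a Slater point.
  have hcomb : Tendsto (fun t : ℝ => (1 - t) • x' + t • s) (𝓝[>] 0) (𝓝 x') := by
    have : Continuous (fun t : ℝ => (1 - t) • x' + t • s) := by fun_prop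
    simpa using (this.tendsto 0).mono_left nhdsWithin_le_nhds
  have hfc := tendsto_of_continuousOn_prod hf hu hθ (fun _ => hu) (fun _ => hθ) hcomb
    tendsto_const_nhds tendsto_const_nhds
  refine ge_of_tendsto (hfc.add_const (ε : ℝ)) ?_
  filter_upwards [Ioc_mem_nhdsGT (zero_lt_one' ℝ)] with t ht
  exact strict _ fun j =>
    strict_of_convex_comb (fun j => hg_conv j u hu θ hθ) hx' hs ht.1 ht.2 j

/-- The distance `d(y, S(u, ε, θ) ⊕ W)` is lower semicontinuous in `(y, u, ε, θ)` jointly: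
near-minimisers along a sequence stay bounded because `W` is bounded, and their limits lie in
`S(u, ε, θ) ⊕ closure W`, which is as far from `y` as `S(u, ε, θ) ⊕ W`. -/
lemma eventually_lt_infEDist_solSet_add {X Υ T : Type*} [NormedAddCommGroup X] [NormedSpace ℝ X]
    [ProperSpace X] [TopologicalSpace Υ] [FirstCountableTopology Υ] [TopologicalSpace T]
    [FirstCountableTopology T] {m : ℕ} {f : X → Υ → T → ℝ}
    {g : Fin m → X → Υ → T → ℝ} {D : Set Υ} {Θ : Set T} {W : Set X}
    (hf : ContinuousOn (fun t : X × Υ × T => f t.1 t.2.1 t.2.2) (Set.univ ×ˢ D ×ˢ Θ))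
    (hg : ∀ j, ContinuousOn (fun t : X × Υ × T => g j t.1 t.2.1 t.2.2) (Set.univ ×ˢ D ×ˢ Θ))
    (hg_conv : ∀ j, ∀ u ∈ D, ∀ θ ∈ Θ, ConvexOn ℝ Set.univ (fun x => g j x u θ))
    (hSlater : ∀ u ∈ D, ∀ θ ∈ Θ, ∃ x, ∀ j, g j x u θ < 0)
    (hW : Bornology.IsBounded W) {y : X} {u : Υ} {q : ℝ≥0 × T} (hu : u ∈ D) (hθ : q.2 ∈ Θ)
    {r : ℝ≥0∞} (hr : r < Metric.infEDist y (solSet f g u q.1 q.2 + W)) :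
    ∀ᶠ t in 𝓝 ((y, u), q), t.1.2 ∈ D → t.2.2 ∈ Θ →
      r < Metric.infEDist t.1.1 (solSet f g t.1.2 t.2.1 t.2.2 + W) := by
  by_contra hcon
  rw [not_eventually] at hcon
  obtain ⟨ns, hns, hbad⟩ := exists_seq_forall_of_frequently hcon
  push Not at hbad
  obtain ⟨r', hrr', hr'⟩ := exists_between hr
  have hy : Tendsto (fun i => (ns i).1.1) atTop (𝓝 y) :=
    ((continuous_fst.comp continuous_fst).tendsto ((y, u), q)).comp hns
  have hul : Tendsto (fun i => (ns i).1.2) atTop (𝓝 u) :=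
    ((continuous_snd.comp continuous_fst).tendsto ((y, u), q)).comp hns
  have hεl : Tendsto (fun i => (ns i).2.1) atTop (𝓝 q.1) :=
    ((continuous_fst.comp continuous_snd).tendsto ((y, u), q)).comp hns
  have hθl : Tendsto (fun i => (ns i).2.2) atTop (𝓝 q.2) :=
    ((continuous_snd.comp continuous_snd).tendsto ((y, u), q)).comp hns
  have hex : ∀ i, ∃ x ∈ solSet f g (ns i).1.2 (ns i).2.1 (ns i).2.2, ∃ w ∈ W,
      edist (ns i).1.1 (x + w) < r' := by
    intro i
    obtain ⟨c, hc, hcr⟩ := Metric.infEDist_lt_iff.1 ((hbad i).2.2.trans_lt hrr')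
    obtain ⟨x, hx, w, hw, rfl⟩ := Set.mem_add.1 hc
    exact ⟨x, hx, w, hw, hcr⟩
  choose xs hxs ws hws hd using hex
  obtain ⟨R, hR⟩ := (Metric.isBounded_range_of_tendsto _ hy).subset_closedBall 0
  have hr'top : r' ≠ ∞ := (hr'.trans_le le_top).ne
  have hcb : ∀ i, xs i + ws i ∈ Metric.closedBall (0 : X) (r'.toReal + R) := by
    intro i
    have h1 : dist (xs i + ws i) (ns i).1.1 ≤ r'.toReal := by
      rw [dist_comm, dist_edist]
      exact ENNReal.toReal_mono hr'top (hd i).le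
    have h2 : dist (ns i).1.1 0 ≤ R := hR ⟨i, rfl⟩
    exact (dist_triangle _ _ _).trans (add_le_add h1 h2)
  have hmem : ∀ i, (xs i + ws i, ws i) ∈ Metric.closedBall (0 : X) (r'.toReal + R) ×ˢ W :=
    fun i => ⟨hcb i, hws i⟩
  obtain ⟨⟨c, w⟩, -, φ, hφ, hlim⟩ := tendsto_subseq_of_bounded
    (Metric.isBounded_closedBall.prod hW) hmem
  have hc : Tendsto (fun i => xs (φ i) + ws (φ i)) atTop (𝓝 c) :=
    (continuous_fst.tendsto (c, w)).comp hlim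
  have hw : Tendsto (fun i => ws (φ i)) atTop (𝓝 w) := (continuous_snd.tendsto (c, w)).comp hlim
  have hx : Tendsto (fun i => xs (φ i)) atTop (𝓝 (c - w)) := by simpa using hc.sub hw
  have hφt := hφ.tendsto_atTop
  have hS : c - w ∈ solSet f g u q.1 q.2 :=
    mem_solSet_of_tendsto hf hg hg_conv hSlater hu hθ (fun i => (hbad (φ i)).1)
      (fun i => (hbad (φ i)).2.1) hx (hul.comp hφt) (hεl.comp hφt) (hθl.comp hφt)
      fun i => hxs (φ i)
  have hcl : c ∈ closure (solSet f g u q.1 q.2 + W) := by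
    have h : Tendsto (fun i => c - w + ws (φ i)) atTop (𝓝 c) := by
      simpa using hw.const_add (c - w)
    exact mem_closure_of_tendsto h
      (Eventually.of_forall fun i => Set.add_mem_add hS (hws (φ i)))
  have hle : Metric.infEDist y (solSet f g u q.1 q.2 + W) ≤ r' := by
    rw [← Metric.infEDist_closure]
    refine (Metric.infEDist_le_edist_of_mem hcl).trans ?_
    exact le_of_tendsto ((hy.comp hφt).edist hc) (Eventually.of_forall fun i => (hd (φ i)).le)
  exact absurd hr' hle.not_gt

/-! ### Divergence of the empirical loss -/

/-- By the second Borel–Cantelli lemma, independent identically distributed variables visit a set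
of positive probability infinitely often. -/
lemma ae_frequently_mem_of_iIndepFun {Ω Z : Type*} [MeasurableSpace Ω] [MeasurableSpace Z]
    {P : Measure Ω} {ζ : ℕ → Ω → Z} (hmeas : ∀ i, Measurable (ζ i)) (hind : iIndepFun ζ P)
    (hid : ∀ i, IdentDistrib (ζ i) (ζ 0) P P) {B : Set Z} (hB : MeasurableSet B)
    (hpos : P (ζ 0 ⁻¹' B) ≠ 0) : ∀ᵐ ω ∂P, ∃ᶠ i in atTop, ζ i ω ∈ B := by
  have := hind.isProbabilityMeasure
  have hms : ∀ i, MeasurableSet (ζ i ⁻¹' B) := fun i => hmeas i hB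
  have hI : iIndepSet (fun i => ζ i ⁻¹' B) P :=
    (iIndepSet_iff_meas_biInter hms).2 fun s =>
      hind.measure_inter_preimage_eq_mul s fun _ _ => hB
  have hsum : ∑' i, P (ζ i ⁻¹' B) = ∞ := by
    simp_rw [fun i => (hid i).measure_mem_eq hB]
    exact ENNReal.tsum_const_eq_top_of_ne_zero hpos
  have h1 := measure_limsup_eq_one hms hI hsum
  have h2 := (prob_compl_eq_zero_iff (MeasurableSet.measurableSet_limsup hms)).2 h1
  filter_upwards [measure_eq_zero_iff_ae_notMem.1 h2] with ω hω
  rw [Set.notMem_compl_iff, mem_limsup_iff_frequently_mem] at hω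
  exact hω

/-- Partial sums of nonnegative functions diverge uniformly on a set on which infinitely many of
them have a common positive lower bound. -/
lemma eventually_forall_lt_sum {Q : Type*} {φ : ℕ → Q → ℝ≥0∞} {N : Set Q} {c B : ℝ≥0∞}
    (hc : c ≠ 0) (hB : B ≠ ∞) (h : ∃ᶠ i in atTop, ∀ q ∈ N, c ≤ φ i q) :
    ∀ᶠ n in atTop, ∀ q ∈ N, B < ∑ i ∈ Finset.range n, φ i q := by
  obtain ⟨M, hM⟩ := ENNReal.exists_nat_mul_gt hc hB
  obtain ⟨t, htsub, htcard⟩ :=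
    (Nat.frequently_atTop_iff_infinite.1 h).exists_subset_card_eq M
  filter_upwards [eventually_gt_atTop (t.sup id)] with n hn q hq
  calc B < M * c := hM
    _ = ∑ _i ∈ t, c := by rw [Finset.sum_const, htcard, nsmul_eq_mul]
    _ ≤ ∑ i ∈ t, φ i q := Finset.sum_le_sum fun i hi => htsub hi q hq
    _ ≤ ∑ i ∈ Finset.range n, φ i q := Finset.sum_le_sum_of_subset fun i hi =>
        Finset.mem_range.2 ((Finset.le_sup (f := id) hi).trans_lt hn)

/-- If positivity of a loss is stable under perturbation of the data `v ∈ D` and of the parameter `q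
∈ A`, and the loss is not almost surely zero at `q₀`, then it is bounded below by some `c > 0` on a
neighbourhood of `q₀`, simultaneously for all data of `D` in an open set of positive probability.
Openness of this set takes the place of the measurability of infima of the loss over neighbourhoods,
which is not available as `D` may fail to be measurable. -/
lemma exists_isOpen_measure_ne_zero {Ω Z Q : Type*} [MeasurableSpace Ω] [TopologicalSpace Z]
    [TopologicalSpace Q] [FirstCountableTopology Q] {P : Measure Ω} {D : Set Z} {A : Set Q}
    {φ : Z → Q → ℝ≥0∞} {q₀ : Q} {ζ : Ω → Z} (hζ : ∀ᵐ ω ∂P, ζ ω ∈ D)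
    (hstable : ∀ v ∈ D, φ v q₀ ≠ 0 →
      ∃ c ≠ 0, ∀ᶠ t in 𝓝 (v, q₀), t.1 ∈ D → t.2 ∈ A → c ≤ φ t.1 t.2)
    (hpos : ∫⁻ ω, φ (ζ ω) q₀ ∂P ≠ 0) :
    ∃ O : Set Z, IsOpen O ∧ P (ζ ⁻¹' O) ≠ 0 ∧ ∃ N ∈ 𝓝 q₀, ∃ c : ℝ≥0∞, c ≠ 0 ∧
      ∀ v ∈ O ∩ D, ∀ q ∈ N ∩ A, c ≤ φ v q := by
  obtain ⟨N, hN⟩ := (𝓝 q₀).exists_antitone_basis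
  let O : ℕ → Set Z := fun n =>
    interior {v | v ∈ D → ∀ q ∈ N n ∩ A, (n + 1 : ℝ≥0∞)⁻¹ ≤ φ v q}
  -- `{φ (ζ ·) q₀ ≠ 0}` may be non-measurable; only subadditivity of the outer measure is used.
  have hcover : ∀ᵐ ω ∂P, φ (ζ ω) q₀ ≠ 0 → ω ∈ ⋃ n, ζ ⁻¹' O n := by
    filter_upwards [hζ] with ω hω hne
    obtain ⟨r, hr0, hev⟩ := hstable _ hω hne
    rw [nhds_prod_eq, eventually_prod_iff] at hev
    obtain ⟨pa, hpa, pb, hpb, hab⟩ := hev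
    obtain ⟨n₁, hn₁⟩ := hN.mem_iff.1 hpb
    obtain ⟨n₂, hn₂⟩ := ENNReal.exists_inv_nat_lt hr0
    refine Set.mem_iUnion.2 ⟨max n₁ n₂, mem_interior_iff_mem_nhds.2 ?_⟩
    filter_upwards [hpa] with v hv hvD q hq
    have hqb : pb q := hn₁ (hN.antitone (le_max_left n₁ n₂) hq.1)
    refine (LE.le.trans ?_ hn₂.le).trans (hab hv hqb hvD hq.2)
    refine ENNReal.inv_le_inv.2 ?_
    have : (n₂ : ℝ≥0∞) ≤ (max n₁ n₂ : ℕ) := Nat.cast_le.2 (le_max_right _ _)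
    exact this.trans le_self_add
  have hex : ∃ n, P (ζ ⁻¹' O n) ≠ 0 := by
    by_contra! hzero
    have hnull : ∀ᵐ ω ∂P, ω ∉ ⋃ n, ζ ⁻¹' O n :=
      measure_eq_zero_iff_ae_notMem.1 (measure_iUnion_null hzero)
    refine hpos ((lintegral_congr_ae ?_).trans lintegral_zero)
    filter_upwards [hcover, hnull] with ω h1 h2
    by_contra h
    exact h2 (h1 h)
  obtain ⟨n, hn⟩ := hex
  refine ⟨O n, isOpen_interior, hn, N n, hN.mem n, (n + 1 : ℝ≥0∞)⁻¹, ?_,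
    fun v hv q hq => interior_subset hv.1 hv.2 q hq⟩
  exact ENNReal.inv_ne_zero.2 (by finiteness)

/-! ### The estimates -/

/-- Comparing a near-minimiser with a parameter of zero empirical loss bounds the total (not only
the average) loss. -/
lemma sum_add_le_of_mem_approxArgmin {X Υ T : Type*} [NormedAddCommGroup X] {m : ℕ}
    {f : X → Υ → T → ℝ} {g : Fin m → X → Υ → T → ℝ} {W : Set X} {u : ℕ → Υ} {y : ℕ → X}
    {n : ℕ} (hn : n ≠ 0) {A : Set (ℝ≥0 × T)} {z : ℝ≥0} {q q₀ : ℝ≥0 × T} (hq₀ : q₀ ∈ A)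
    (hzero : ∀ i, sqDist (y i) (solSet f g (u i) q₀.1 q₀.2 + W) = 0)
    (hq : q ∈ approxArgmin (abpObjective f g W u y n (1 / (n : ℝ≥0))) A z) :
    ∑ i ∈ Finset.range n, sqDist (y i) (solSet f g (u i) q.1 q.2 + W) + q.1
      ≤ ((q₀.1 + n * z : ℝ≥0) : ℝ≥0∞) := by
  have h1 := hq.2.trans (add_le_add_left (iInf₂_le q₀ hq₀) (z : ℝ≥0∞))
  have hn0 : (n : ℝ≥0∞) ≠ 0 := Nat.cast_ne_zero.2 hn
  have hnt : (n : ℝ≥0∞) ≠ ∞ := ENNReal.natCast_ne_top n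
  have hlam : ((1 / (n : ℝ≥0) : ℝ≥0) : ℝ≥0∞) = (n : ℝ≥0∞)⁻¹ := by
    rw [one_div, ENNReal.coe_inv (Nat.cast_ne_zero.2 hn), ENNReal.coe_natCast]
  simp only [abpObjective, hzero, Finset.sum_const_zero, mul_zero, zero_add, hlam] at h1
  have h2 := mul_le_mul_right h1 (n : ℝ≥0∞)
  simp only [mul_add, ← mul_assoc, ENNReal.mul_inv_cancel hn0 hnt, one_mul] at h2
  simpa using h2

end InverseApproxOpt

theorem mainTheorem1
    {p d k m : ℕ}
    -- the parametric convex program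
    (f : EuclideanSpace ℝ (Fin p) → EuclideanSpace ℝ (Fin d) → EuclideanSpace ℝ (Fin k) → ℝ)
    (g : Fin m →
      EuclideanSpace ℝ (Fin p) → EuclideanSpace ℝ (Fin d) → EuclideanSpace ℝ (Fin k) → ℝ)
    (D : Set (EuclideanSpace ℝ (Fin d)))
    (E : Set ℝ≥0) (Θ : Set (EuclideanSpace ℝ (Fin k)))
    (hf_cont : ContinuousOn
      (fun t : EuclideanSpace ℝ (Fin p) × EuclideanSpace ℝ (Fin d) × EuclideanSpace ℝ (Fin k) =>
        f t.1 t.2.1 t.2.2) (Set.univ ×ˢ D ×ˢ Θ))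
    (hg_cont : ∀ j, ContinuousOn
      (fun t : EuclideanSpace ℝ (Fin p) × EuclideanSpace ℝ (Fin d) × EuclideanSpace ℝ (Fin k) =>
        g j t.1 t.2.1 t.2.2) (Set.univ ×ˢ D ×ˢ Θ))
    (hf_conv : ∀ u ∈ D, ∀ θ ∈ Θ, ConvexOn ℝ Set.univ (fun x => f x u θ))
    (hg_conv : ∀ j, ∀ u ∈ D, ∀ θ ∈ Θ, ConvexOn ℝ Set.univ (fun x => g j x u θ))
    (hSlater : ∀ u ∈ D, ∀ θ ∈ Θ, ∃ x, ∀ j, g j x u θ < 0)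
    -- the parameter sets and the true parameters
    (hE : IsClosed E) (hΘ : IsCompact Θ)
    (ε₀ : ℝ≥0) (θ₀ : EuclideanSpace ℝ (Fin k)) (hε₀ : ε₀ ∈ E) (hθ₀ : θ₀ ∈ Θ)
    -- the noise set
    (W : Set (EuclideanSpace ℝ (Fin p)))
    (hW_conv : Convex ℝ W) (hW_bdd : Bornology.IsBounded W)
    -- the random sample
    {Ω : Type*} [MeasurableSpace Ω] (P : Measure Ω) [IsProbabilityMeasure P]
    (U : ℕ → Ω → EuclideanSpace ℝ (Fin d))
    (X Wn Y : ℕ → Ω → EuclideanSpace ℝ (Fin p))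
    (hU_meas : ∀ i, Measurable (U i)) (hX_meas : ∀ i, Measurable (X i))
    (hWn_meas : ∀ i, Measurable (Wn i))
    (h_indep : iIndepFun (fun i ω => (U i ω, X i ω, Wn i ω)) P)
    (h_ident : ∀ i, IdentDistrib (fun ω => (U i ω, X i ω, Wn i ω))
      (fun ω => (U 0 ω, X 0 ω, Wn 0 ω)) P P)
    (hU : ∀ i, ∀ᵐ ω ∂P, U i ω ∈ D)
    (hX : ∀ i, ∀ᵐ ω ∂P, X i ω ∈ InverseApproxOpt.solSet f g (U i ω) ε₀ θ₀)
    (hWn : ∀ i, ∀ᵐ ω ∂P, Wn i ω ∈ W)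
    (hWn_mean : ∀ i, ∫ ω, Wn i ω ∂P = 0)
    (hY : ∀ i ω, Y i ω = X i ω + Wn i ω)
    -- identifiability
    (h_identif : ∀ ε ∈ E, ε ≤ ε₀ → ∀ θ ∈ Θ, (ε, θ) ≠ (ε₀, θ₀) → ∀ i,
      0 < ∫⁻ ω, InverseApproxOpt.sqDist (Y i ω)
        (InverseApproxOpt.solSet f g (U i ω) ε θ + W) ∂P)
    -- the regularization weights, the tolerances and the estimates
    (lam z : ℕ → ℝ≥0)
    (hlam : ∀ n, 1 ≤ n → lam n = 1 / (n : ℝ≥0))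
    (hz : Tendsto (fun n : ℕ => (n : ℝ≥0) * z n) atTop (𝓝 0))
    (εhat : ℕ → Ω → ℝ≥0) (θhat : ℕ → Ω → EuclideanSpace ℝ (Fin k))
    (hest : ∀ n, 1 ≤ n → ∀ᵐ ω ∂P, (εhat n ω, θhat n ω) ∈
      InverseApproxOpt.approxArgmin
        (InverseApproxOpt.abpObjective f g W (fun i => U i ω) (fun i => Y i ω) n (lam n))
        (E ×ˢ Θ) (z n)) :
    ∀ᵐ ω ∂P, Tendsto (fun n => (εhat n ω, θhat n ω)) atTop (𝓝 (ε₀, θ₀)) := by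
  let φ : EuclideanSpace ℝ (Fin d) × EuclideanSpace ℝ (Fin p) × EuclideanSpace ℝ (Fin p) →
      ℝ≥0 × EuclideanSpace ℝ (Fin k) → ℝ≥0∞ := fun v q =>
    InverseApproxOpt.sqDist (v.2.1 + v.2.2) (InverseApproxOpt.solSet f g v.1 q.1 q.2 + W)
  have hstable : ∀ q ∈ E ×ˢ Θ, ∀ v ∈ {v | v.1 ∈ D}, φ v q ≠ 0 → ∃ c ≠ 0,
      ∀ᶠ t in 𝓝 (v, q), t.1 ∈ {v | v.1 ∈ D} → t.2 ∈ E ×ˢ Θ → c ≤ φ t.1 t.2 := by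
    intro q hq v hv hne
    obtain ⟨r, hr0, hr⟩ := exists_between (pos_iff_ne_zero.2 ((pow_ne_zero_iff two_ne_zero).1 hne))
    refine ⟨r ^ 2, pow_ne_zero 2 hr0.ne', ?_⟩
    have hev := InverseApproxOpt.eventually_lt_infEDist_solSet_add hf_cont hg_cont hg_conv
      hSlater hW_bdd hv hq.2 hr
    have hcont : Continuous
        (fun t : (EuclideanSpace ℝ (Fin d) × EuclideanSpace ℝ (Fin p) × EuclideanSpace ℝ (Fin p))
          × (ℝ≥0 × EuclideanSpace ℝ (Fin k)) => ((t.1.2.1 + t.1.2.2, t.1.1), t.2)) := by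
      fun_prop
    filter_upwards [(hcont.tendsto (v, q)).eventually hev] with t ht htD htA
    exact pow_le_pow_left₀ zero_le (ht htD htA.2).le 2
  have hdata : ∀ᵐ ω ∂P, ∀ i, U i ω ∈ D ∧ InverseApproxOpt.sqDist (Y i ω)
      (InverseApproxOpt.solSet f g (U i ω) ε₀ θ₀ + W) = 0 := by
    refine ae_all_iff.2 fun i => ?_
    filter_upwards [hU i, hX i, hWn i] with ω h1 h2 h3
    refine ⟨h1, ?_⟩
    rw [InverseApproxOpt.sqDist, hY, Metric.infEDist_zero_of_mem (Set.add_mem_add h2 h3),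
      zero_pow two_ne_zero]
  -- The comparison with the true parameter bounds the estimates `ε̂ₙ` and the total losses.
  have hbound : ∀ᵐ ω ∂P, ∀ n, 1 ≤ n → (εhat n ω, θhat n ω) ∈ E ×ˢ Θ ∧
      ∑ i ∈ Finset.range n, φ (U i ω, X i ω, Wn i ω) (εhat n ω, θhat n ω) + εhat n ω
        ≤ ((ε₀ + n * z n : ℝ≥0) : ℝ≥0∞) := by
    filter_upwards [hdata, ae_all_iff.2 fun n => eventually_imp_distrib_left.2 (hest n)]
      with ω h1 h2 n hn
    have h3 := h2 n hn
    rw [hlam n hn] at h3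
    refine ⟨h3.1, ?_⟩
    have h4 := InverseApproxOpt.sum_add_le_of_mem_approxArgmin (Nat.one_le_iff_ne_zero.1 hn)
      (A := E ×ˢ Θ) (q₀ := (ε₀, θ₀)) ⟨hε₀, hθ₀⟩ (fun i => (h1 i).2) h3
    simpa only [φ, hY] using h4
  have hlim : Tendsto (fun n : ℕ => ε₀ + (n : ℝ≥0) * z n) atTop (𝓝 ε₀) := by
    simpa using hz.const_add ε₀
  -- A wrong parameter `q` with `q.1 ≤ ε₀` has a neighbourhood that the estimates finally leave.
  have hleave : ∀ q ∈ (E ×ˢ Θ) ∩ {q | q.1 ≤ ε₀ ∧ q ≠ (ε₀, θ₀)}, ∃ N ∈ 𝓝 q,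
      ∀ᵐ ω ∂P, ∀ᶠ n in atTop, (εhat n ω, θhat n ω) ∉ N := by
    rintro q ⟨hqA, hqε, hq₀⟩
    have hpos : ∫⁻ ω, φ (U 0 ω, X 0 ω, Wn 0 ω) q ∂P ≠ 0 := by
      have := (h_identif q.1 hqA.1 hqε q.2 hqA.2 hq₀ 0).ne'
      simpa only [φ, hY] using this
    obtain ⟨O, hO, hPO, N, hN, c, hc, hcN⟩ :=
      InverseApproxOpt.exists_isOpen_measure_ne_zero (D := {v | v.1 ∈ D}) (hU 0)
        (hstable q hqA) hpos
    have hfreq := InverseApproxOpt.ae_frequently_mem_of_iIndepFun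
      (fun i => (hU_meas i).prodMk ((hX_meas i).prodMk (hWn_meas i))) h_indep h_ident
      hO.measurableSet hPO
    refine ⟨N, hN, ?_⟩
    filter_upwards [hfreq, hdata, hbound] with ω h1 h2 h3
    have h4 := InverseApproxOpt.eventually_forall_lt_sum hc
      (ENNReal.coe_ne_top (r := ε₀ + 1)) (h1.mono fun i hi => hcN _ ⟨hi, (h2 i).1⟩)
    filter_upwards [h4, eventually_ge_atTop 1,
      hlim.eventually_lt_const (lt_add_one ε₀)] with n h5 hn h6 hmem
    have h7 := (h5 _ ⟨hmem, (h3 n hn).1⟩).trans_le (le_self_add.trans (h3 n hn).2)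
    exact h6.not_gt (ENNReal.coe_lt_coe.1 h7)
  choose! N hN hNleave using hleave
  obtain ⟨t, htsub, htc, htcover⟩ := TopologicalSpace.countable_cover_nhdsWithin
    fun q hq => mem_nhdsWithin_of_mem_nhds (interior_mem_nhds.2 (hN q hq))
  filter_upwards [hbound, (ae_ball_iff htc).2 fun q hq => hNleave q (htsub hq)] with ω h1 h2
  have hεle : ∀ n, 1 ≤ n → εhat n ω ≤ ε₀ + n * z n := fun n hn =>
    ENNReal.coe_le_coe.1 (le_add_self.trans (h1 n hn).2)
  have hK : IsCompact ((E ∩ Set.Icc 0 (ε₀ + 1)) ×ˢ Θ) := (isCompact_Icc.inter_left hE).prod hΘ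
  refine hK.tendsto_nhds_of_unique_mapClusterPt ?_ fun q hq hcl => ?_
  · filter_upwards [eventually_ge_atTop 1, hlim.eventually_lt_const (lt_add_one ε₀)] with n hn h3
    exact ⟨⟨(h1 n hn).1.1, zero_le, (hεle n hn).trans h3.le⟩, (h1 n hn).1.2⟩
  · by_contra hne
    have hqε : q.1 ≤ ε₀ := by
      by_contra! hlt
      obtain ⟨b, hb, hbq⟩ := exists_between hlt
      have h3 := hcl.frequently ((continuous_fst.tendsto q).eventually_const_lt hbq)
      obtain ⟨n, h4, hn, h5⟩ :=
        (h3.and_eventually ((eventually_ge_atTop 1).and (hlim.eventually_lt_const hb))).exists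
      exact h4.not_ge ((hεle n hn).trans h5.le)
    obtain ⟨q', hq', hmem⟩ := Set.mem_iUnion₂.1 (htcover ⟨⟨hq.1.1, hq.2⟩, hqε, hne⟩)
    have h3 := hcl.frequently (mem_interior_iff_mem_nhds.1 hmem)
    obtain ⟨n, h4, h5⟩ := (h3.and_eventually (h2 q' hq')).exists
    exact h5 h4
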